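/- Let $\mathcal X$ be a compact metric space, $P$ a Borel probability measure on $\mathcal X$, and $k:\mathcal X\times\mathcal X\to\mathbb R$ a continuous symmetric function for which there is $l>0$ with $k(x,y)>l$ for all $x,y$. Let $n\ge 1$, let $X_1,\dots,X_n\in\mathcal X$ be sample points, and let $P_n=\frac1n\sum_{i}\delta_{X_i}$. Put $d(x)=\int k(x,y)\,dP(y)$ and $d_n(x)=\int k(x,y)\,dP_n(y)$, and define bounded operators on $(C(\mathcal X),\|\cdot\|_\infty)$ by $$Uf(x)=d(x)f(x)-\int k(x,y)f(y)\,dP(y),\qquad U_nf(x)=d_n(x)f(x)-\int k(x,y)f(y)\,dP_n(y).$$ Let $K_n=(k(X_i,X_j))_{i,j\le n}$, let $D_n$ be the diagonal matrix with entries $\sum_{j}k(X_i,X_j)$, let $L_n=D_n-K_n$, and let $\rho_nf=(f(X_1),\dots,f(X_n))^t$. Write $\operatorname{rg}$ for the range of a function. The essential spectrum $\sigma_{\mathrm{ess}}(T)$ of a bounded operator $T$ is its spectrum without the isolated eigenvalues of finite algebraic multiplicity (the dimension of the range of the spectral projection); for this, $C(\mathcal X)$ consists of complex-valued functions. Parts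 1–3 hold for real and for complex scalars. 1. If $f\in C(\mathcal X)$ is an eigenfunction of $U_n$ with arbitrary eigenvalue $\lambda$, then $v=\rho_nf$ satisfies $\frac1nL_nv=\lambda v$. Moreover $v\ne0$, so that $v$ is an eigenvector of $\frac1nL_n$ with eigenvalue $\lambda$, whenever $f(x)\neq 0$ for some $x$ with $d_n(x)\ne\lambda$; in particular whenever $\lambda\notin\operatorname{rg}(d_n)$. 2. If $\lambda\notin\operatorname{rg}(d_n)$ is an eigenvalue of $U_n$ with eigenfunction $f\in C(\mathcal X)$ and $v=(v_1,\dots,v_n)=\rho_nf$, then $$f(x)=\frac{\frac1n\sum_{j}k(x,X_j)v_j}{d_n(x)-\lambda}\qquad(x\in\mathcal X).\tag{$*$}$$ 3. If $v$ is an eigenvector of $\frac1nL_n$ with eigenvalue $\lambda\notin\operatorname{rg}(d_n)$, then $f$ defined by $(*)$ is in $C(\mathcal X)$, is an eigenfunction of $U_n$ with eigenvalue $\lambda$, and satisfies $\rho_nf=v$. 4. $\sigma_{\mathrm{ess}}(U_n)\subseteq\operatorname{rg}(d_n)$, and if $\mathcal X$ has no isolated points, then $\sigma_{\mathrm{ess}}(U_n)=\operatorname{rg}(d_n)$.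 All eigenvalues of $U_n$ are real and nonnegative, and the set of eigenvalues has accumulation points only in $\operatorname{rg}(d_n)$. The same statements hold with $U$, $d$ in place of $U_n$, $d_n$. -/

import Mathlib

open MeasureTheory Set Filter Topology
open scoped NNReal

namespace SpectralClustering

noncomputable section

/-! ### Essential spectrum of a bounded operator on a complex Banach space -/

section EssentialSpectrum

variable {E : Type*} [NormedAddCommGroup E] [NormedSpace ℂ E]

/-- The spectral (Riesz) projection `(2πi)⁻¹ ∮ (ζ - T)⁻¹ dζ` over the positively oriented circle
with centre `z` and radius `r`. It is only used when the closed disc of radius `r` around `z`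
meets the spectrum of `T` in the single point `z`. -/
def spectralProjection (T : E →L[ℂ] E) (z : ℂ) (r : ℝ) : E →L[ℂ] E :=
  (2 * (Real.pi : ℂ) * Complex.I)⁻¹ • ∮ ζ in C(z, r), resolvent T ζ

/-- The discrete spectrum: the eigenvalues of `T` that are isolated points of the spectrum and have
finite algebraic multiplicity, i.e. whose spectral projection has finite-dimensional range. -/
def discreteSpectrum (T : E →L[ℂ] E) : Set ℂ :=
  {z | Module.End.HasEigenvalue (T : E →ₗ[ℂ] E) z ∧
    ∃ r : ℝ, 0 < r ∧ spectrum ℂ T ∩ Metric.closedBall z r = {z} ∧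
      FiniteDimensional ℂ (spectralProjection T z r : E →ₗ[ℂ] E).range}

/-- The essential spectrum: the part of the spectrum outside the discrete spectrum. -/
def essentialSpectrum (T : E →L[ℂ] E) : Set ℂ :=
  spectrum ℂ T \ discreteSpectrum T

end EssentialSpectrum

/-! ### Degree functions and operators on `C(𝒳)` -/

section Operators

variable {𝒳 : Type*} [MetricSpace 𝒳] [CompactSpace 𝒳] [MeasurableSpace 𝒳] [BorelSpace 𝒳]

theorem continuous_integral_of_continuous {F : Type*} [NormedAddCommGroup F] [NormedSpace ℝ F]
    (μ : Measure 𝒳) [IsFiniteMeasure μ] (g : 𝒳 → 𝒳 → F) (hg : Continuous (Function.uncurry g)) :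
    Continuous fun a => ∫ b, g a b ∂μ := by
  have h := continuous_parametric_integral_of_continuous (μ := μ) hg isCompact_univ
  simpa using h

theorem integrable_of_continuous {F : Type*} [NormedAddCommGroup F]
    (μ : Measure 𝒳) [IsFiniteMeasure μ] (g : 𝒳 → F) (hg : Continuous g) : Integrable g μ := by
  have h := hg.continuousOn.integrableOn_compact (μ := μ) isCompact_univ
  simpa using h

/-- The degree function `a ↦ ∫ k(a, b) dμ(b)`. -/
def degree (k : C(𝒳 × 𝒳, ℝ)) (μ : Measure 𝒳) [IsFiniteMeasure μ] : C(𝒳, ℝ) where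
  toFun a := ∫ b, k (a, b) ∂μ
  continuous_toFun := continuous_integral_of_continuous μ (fun a b => k (a, b)) (by fun_prop)

variable (𝕜 : Type*) [RCLike 𝕜]

/-- The degree function with its real values regarded as elements of `𝕜` (`ℝ` or `ℂ`). -/
def degreeIn (k : C(𝒳 × 𝒳, ℝ)) (μ : Measure 𝒳) [IsFiniteMeasure μ] : C(𝒳, 𝕜) where
  toFun a := (degree k μ a : 𝕜)
  continuous_toFun := RCLike.continuous_ofReal.comp (degree k μ).continuous

/-- The multiplication operator `f ↦ d f` on `C(𝒳)`, where `d` is the degree function. -/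
def mulOp (k : C(𝒳 × 𝒳, ℝ)) (μ : Measure 𝒳) [IsFiniteMeasure μ] : C(𝒳, 𝕜) →L[𝕜] C(𝒳, 𝕜) :=
  ContinuousLinearMap.mul 𝕜 C(𝒳, 𝕜) (degreeIn 𝕜 k μ)

/-- The integral operator `(S f)(a) = ∫ k(a, b) f(b) dμ(b)` on `C(𝒳)`. -/
def integralOp (k : C(𝒳 × 𝒳, ℝ)) (μ : Measure 𝒳) [IsFiniteMeasure μ] :
    C(𝒳, 𝕜) →L[𝕜] C(𝒳, 𝕜) :=
  LinearMap.mkContinuous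
    { toFun := fun f =>
        { toFun := fun a => ∫ b, (k (a, b) : 𝕜) * f b ∂μ
          continuous_toFun := continuous_integral_of_continuous μ
            (fun a b => (k (a, b) : 𝕜) * f b) (by
              have : Continuous fun p : 𝒳 × 𝒳 => ((k p : ℝ) : 𝕜) :=
                RCLike.continuous_ofReal.comp k.continuous
              exact this.mul (f.continuous.comp continuous_snd)) }
      map_add' := fun f g => by
        have hk : ∀ a, Continuous fun b => ((k (a, b) : ℝ) : 𝕜) := fun a =>
          RCLike.continuous_ofReal.comp (k.continuous.comp (by fun_prop))
        ext a
        simp only [ContinuousMap.add_apply, ContinuousMap.coe_mk, mul_add]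
        exact integral_add
          (integrable_of_continuous μ _ ((hk a).mul f.continuous))
          (integrable_of_continuous μ _ ((hk a).mul g.continuous))
      map_smul' := fun c f => by
        ext a
        simp only [ContinuousMap.smul_apply, ContinuousMap.coe_mk, RingHom.id_apply, smul_eq_mul,
          mul_left_comm _ c]
        exact integral_const_mul c _ }
    (‖k‖ * μ.real univ) (fun f => by
      refine (ContinuousMap.norm_le _ (by positivity)).2 fun a => ?_
      have h : ‖∫ b, (k (a, b) : 𝕜) * f b ∂μ‖ ≤ ‖k‖ * ‖f‖ * μ.real univ := by
        refine norm_integral_le_of_norm_le_const (Eventually.of_forall fun b => ?_)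
        rw [norm_mul, RCLike.norm_ofReal]
        exact mul_le_mul (k.norm_coe_le_norm (a, b)) (f.norm_coe_le_norm b)
          (norm_nonneg _) (norm_nonneg _)
      calc _ ≤ ‖k‖ * ‖f‖ * μ.real univ := h
        _ = ‖k‖ * μ.real univ * ‖f‖ := by ring)

/-- The operator `U = M_d - S` on `C(𝒳)` for the measure `μ`. -/
def lapOp (k : C(𝒳 × 𝒳, ℝ)) (μ : Measure 𝒳) [IsFiniteMeasure μ] : C(𝒳, 𝕜) →L[𝕜] C(𝒳, 𝕜) :=
  mulOp 𝕜 k μ - integralOp 𝕜 k μ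

end Operators

/-! ### Sample points: empirical distribution, graph Laplacian, restriction, extension -/

section Sample

variable {𝒳 : Type*} {n : ℕ}

/-- The empirical distribution `(1/n) ∑ δ_{X_i}` of the sample points `X_1, …, X_n`. -/
def empiricalMeasure [MeasurableSpace 𝒳] (X : Fin n → 𝒳) : Measure 𝒳 :=
  ((n : ℝ≥0)⁻¹) • ∑ i, Measure.dirac (X i)

instance [MeasurableSpace 𝒳] (X : Fin n → 𝒳) : IsFiniteMeasure (empiricalMeasure X) := by
  unfold empiricalMeasure
  infer_instance

variable [TopologicalSpace 𝒳]

/-- The similarity matrix `K_n = (k(X_i, X_j))`. -/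
def simMatrix (k : C(𝒳 × 𝒳, ℝ)) (X : Fin n → 𝒳) : Matrix (Fin n) (Fin n) ℝ :=
  Matrix.of fun i j => k (X i, X j)

/-- The degree matrix `D_n`. -/
def degMatrix (k : C(𝒳 × 𝒳, ℝ)) (X : Fin n → 𝒳) : Matrix (Fin n) (Fin n) ℝ :=
  Matrix.diagonal fun i => ∑ j, k (X i, X j)

/-- The unnormalized graph Laplacian `L_n = D_n - K_n`. -/
def graphLaplacian (k : C(𝒳 × 𝒳, ℝ)) (X : Fin n → 𝒳) : Matrix (Fin n) (Fin n) ℝ :=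
  degMatrix k X - simMatrix k X

variable (𝕜 : Type*) [RCLike 𝕜]

/-- The linear endomorphism of `𝕜ⁿ` given by the real matrix `(1/n) L_n`. -/
def scaledLaplacian (k : C(𝒳 × 𝒳, ℝ)) (X : Fin n → 𝒳) : Module.End 𝕜 (Fin n → 𝕜) :=
  Matrix.toLin' ((((n : ℝ)⁻¹) • graphLaplacian k X).map (fun t : ℝ => (t : 𝕜)))

variable {𝕜}

/-- The restriction `ρ_n f = (f(X_1), …, f(X_n))`. -/
def sampleRestrict (X : Fin n → 𝒳) (f : C(𝒳, 𝕜)) : Fin n → 𝕜 := fun i => f (X i)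

end Sample

/-! ### The empirical operator `U_n` and the extension formula -/

section Empirical

variable {𝒳 : Type*} [MetricSpace 𝒳] [CompactSpace 𝒳] [MeasurableSpace 𝒳] [BorelSpace 𝒳] {n : ℕ}
  (𝕜 : Type*) [RCLike 𝕜]

/-- The empirical degree function `d_n`. -/
def empDegree (k : C(𝒳 × 𝒳, ℝ)) (X : Fin n → 𝒳) : C(𝒳, 𝕜) :=
  degreeIn 𝕜 k (empiricalMeasure X)

/-- The operator `U_n = M_{d_n} - S_n`. -/
def empLapOp (k : C(𝒳 × 𝒳, ℝ)) (X : Fin n → 𝒳) : C(𝒳, 𝕜) →L[𝕜] C(𝒳, 𝕜) :=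
  lapOp 𝕜 k (empiricalMeasure X)

variable {𝕜}

/-- The function `a ↦ ((1/n) ∑_j k(a, X_j) v_j) / (d_n(a) - z)`. -/
def extension (k : C(𝒳 × 𝒳, ℝ)) (X : Fin n → 𝒳) (z : 𝕜) (v : Fin n → 𝕜) : 𝒳 → 𝕜 := fun a =>
  ((n : 𝕜)⁻¹ * ∑ j, (k (a, X j) : 𝕜) * v j) / (empDegree 𝕜 k X a - z)

end Empirical

/-- `z` is an eigenvalue of the operator `T` with eigenvector `f`. -/
def IsEigenvector {𝕜 E : Type*} [RCLike 𝕜] [NormedAddCommGroup E] [NormedSpace 𝕜 E]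
    (T : E →L[𝕜] E) (z : 𝕜) (f : E) : Prop :=
  Module.End.HasEigenvector (T : E →ₗ[𝕜] E) z f

/-- The set of eigenvalues of the operator `T`. -/
def eigenvalueSet {𝕜 E : Type*} [RCLike 𝕜] [NormedAddCommGroup E] [NormedSpace 𝕜 E]
    (T : E →L[𝕜] E) : Set 𝕜 :=
  {z | Module.End.HasEigenvalue (T : E →ₗ[𝕜] E) z}

end

end SpectralClustering

open SpectralClustering

/-! The eigenvalue equation reads `(d - z) f = S f` with `S` the integral operator. For the
empirical measure, `S f` depends on `f` only through its values at the sample points, so sampling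
the equation gives the matrix equation, and dividing by `d_n - z` recovers `f`. This settles parts
1–3.

Part 4 is proved for an arbitrary finite measure, hence for `P` and `P_n` at once. By Arzelà–Ascoli
`S` is compact. Off `rg d` the operator `z - M_d` is invertible, so by the Fredholm alternative a
spectral value `z` is an eigenvalue with finite-dimensional eigenspace `N`. Algebraic multiplicity
and isolation come from symmetry in `L²(μ)`: the map `C(𝒳) → L²(μ)` need not be injective, but it is
so on `N`, and orthogonal projection yields a bounded projection `p` onto `N` commuting with `U`.
Then `z - (U - p)` is invertible, which gives the resolvent of `U` near `z` explicitly and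
identifies the Riesz projection with `p` (`mem_discreteSpectrum_lapOp`).

Conversely, if `z` is not in the essential spectrum, then `z - U`, and hence `z - M_d`, is left
invertible modulo compact operators. For `z = d(a)` with `a` not isolated, separated bump functions
concentrating at `a` rule this out (`range_degreeIn_subset_essentialSpectrum`).

Eigenvalues are real by symmetry and nonnegative by evaluation at a maximum of `|f|`. -/

namespace SpectralClustering

/-! ### Compact perturbations of invertible operators -/

section CompactPerturbation

variable {E : Type*} [NormedAddCommGroup E] [NormedSpace ℂ E]

/-- Factor `B - C = B (1 - B⁻¹ C)` and apply the Fredholm alternative to the compact operator `B⁻¹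
C` at the value `1`. -/
theorem isUnit_sub_of_injective [CompleteSpace E] {B C : E →L[ℂ] E} (hB : IsUnit B)
    (hC : IsCompactOperator C) (hinj : ∀ f, (B - C) f = 0 → f = 0) : IsUnit (B - C) := by
  obtain ⟨u, rfl⟩ := hB
  set K : E →L[ℂ] E := ↑u⁻¹ * C with hK
  have hKc : IsCompactOperator K := hC.clm_comp (↑u⁻¹ : E →L[ℂ] E)
  have hfac : (u : E →L[ℂ] E) - C = u * (algebraMap ℂ (E →L[ℂ] E) 1 - K) := by
    rw [mul_sub, hK, ← mul_assoc, Units.mul_inv, map_one, mul_one, one_mul]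
  rcases hKc.hasEigenvalue_or_mem_resolventSet (one_ne_zero (α := ℂ)) with h | h
  · obtain ⟨f, hf⟩ := h.exists_hasEigenvector
    refine absurd (hinj f ?_) hf.2
    have h1 : K f = f := by simpa using hf.apply_eq_smul
    rw [hfac]
    simp [h1]
  · rw [hfac]
    exact u.isUnit.mul h

/-- On `N` the compact operator `B⁻¹ C` is the identity, and a compact identity forces finite
dimension. -/
theorem finiteDimensional_of_forall_sub_eq_zero {B C : E →L[ℂ] E} [CompleteSpace E]
    (hB : IsUnit B) (hC : IsCompactOperator C) (N : Submodule ℂ E) (hN : IsClosed (N : Set E))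
    (h : ∀ f ∈ N, (B - C) f = 0) : FiniteDimensional ℂ N := by
  obtain ⟨u, rfl⟩ := hB
  have hKc : IsCompactOperator ((↑u⁻¹ * C : E →L[ℂ] E) : E →ₗ[ℂ] E) :=
    hC.clm_comp (↑u⁻¹ : E →L[ℂ] E)
  have hK : ∀ f ∈ N, (↑u⁻¹ * C : E →L[ℂ] E) f = f := fun f hf => by
    have h1 : (u : E →L[ℂ] E) f = C f := sub_eq_zero.1 (h f hf)
    have h2 : ((↑u⁻¹ * ↑u : E →L[ℂ] E)) f = f := by rw [Units.inv_mul]; rfl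
    rw [mul_apply_eq_comp] at h2 ⊢
    rw [← h1, h2]
  have hmem : ∀ f ∈ N, ((↑u⁻¹ * C : E →L[ℂ] E) : E →ₗ[ℂ] E) f ∈ N := fun f hf => by
    have := hK f hf
    simp only [ContinuousLinearMap.coe_coe, this, hf]
  have hr := hKc.restrict hmem hN
  refine FiniteDimensional.of_isCompactOperator_id (𝕜 := ℂ) ?_
  have hid : ⇑((((↑u⁻¹ * C : E →L[ℂ] E) : E →ₗ[ℂ] E)).restrict hmem) = id :=
    funext fun f => Subtype.ext (hK f f.2)
  rwa [hid] at hr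

/-- An operator that is left invertible modulo the compact operators does not send to zero any
bounded sequence without a convergent subsequence. -/
theorem not_tendsto_zero_of_mul_eq_one_sub {Q A K : E →L[ℂ] E} (hK : IsCompactOperator K)
    (hQ : Q * A = 1 - K) (f : ℕ → E) (hf : ∀ m, ‖f m‖ ≤ 1)
    (hsep : ∀ m j, m < j → 1 ≤ ‖f m - f j‖) : ¬ Tendsto (fun m => A (f m)) atTop (𝓝 0) := by
  intro hA
  obtain ⟨S, hS, hS'⟩ := hK.image_closedBall_subset_compact 1
  obtain ⟨y, -, ψ, hψ, hψy⟩ := hS.tendsto_subseq (fun m => hS' ⟨f m, by simp [hf m], rfl⟩)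
  -- Since `f = Q A f + K f`, where the first term tends to zero and the second converges along `ψ`,
  -- the subsequence itself converges, against the separation.
  have hconv : Tendsto (fun m => f (ψ m)) atTop (𝓝 y) := by
    have h1 : Tendsto (fun m => Q (A (f (ψ m)))) atTop (𝓝 0) := by
      have := (Q.continuous.tendsto 0).comp (hA.comp hψ.tendsto_atTop)
      rwa [map_zero] at this
    have h2 := h1.add hψy
    rw [zero_add] at h2
    refine h2.congr fun m => ?_
    have h3 : Q (A (f (ψ m))) = f (ψ m) - K (f (ψ m)) := by
      have := congrArg (fun T : E →L[ℂ] E => T (f (ψ m))) hQ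
      simpa using this
    simp [h3]
  have hc := hconv.cauchySeq
  rw [Metric.cauchySeq_iff'] at hc
  obtain ⟨N, hN⟩ := hc 1 one_pos
  have h4 := hN (N + 1) (Nat.le_succ N)
  rw [dist_eq_norm, norm_sub_rev] at h4
  exact absurd (hsep _ _ (hψ (Nat.lt_succ_self N))) (not_le.2 h4)

theorem resolvent_mul_sub {T : E →L[ℂ] E} {ζ : ℂ} (h : ζ ∈ resolventSet ℂ T) :
    resolvent T ζ * (algebraMap ℂ (E →L[ℂ] E) ζ - T) = 1 :=
  Ring.inverse_mul_cancel _ h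

end CompactPerturbation

/-! ### Riesz projections and the discrete spectrum -/

section Riesz

variable {E : Type*} [NormedAddCommGroup E] [NormedSpace ℂ E] [CompleteSpace E]

theorem continuousOn_resolvent (T : E →L[ℂ] E) {s : Set ℂ} (hs : s ⊆ resolventSet ℂ T) :
    ContinuousOn (resolvent T) s := fun _ hζ =>
  (spectrum.hasDerivAt_resolvent_const_left (hs hζ)).continuousAt.continuousWithinAt

theorem circleIntegral_mul_const (g : ℂ → E →L[ℂ] E) (B : E →L[ℂ] E) {z : ℂ} {r : ℝ}
    (hg : CircleIntegrable g z r) : (∮ ζ in C(z, r), g ζ) * B = ∮ ζ in C(z, r), g ζ * B := by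
  have h := ((ContinuousLinearMap.mul ℂ (E →L[ℂ] E)).flip B).intervalIntegral_comp_comm hg.out
  simpa [circleIntegral] using h.symm

/-- `z - T` is left invertible modulo the range of the spectral projection. -/
theorem exists_mul_eq_one_sub_spectralProjection (T : E →L[ℂ] E) (z : ℂ) {r : ℝ} (hr : 0 < r)
    (hres : Metric.sphere z r ⊆ resolventSet ℂ T) :
    ∃ Q : E →L[ℂ] E,
      Q * (algebraMap ℂ (E →L[ℂ] E) z - T) = 1 - spectralProjection T z r := by
  have hne : ∀ ζ ∈ Metric.sphere z r, ζ - z ≠ 0 := fun ζ hζ h => by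
    rw [sub_eq_zero] at h
    subst h
    simp [hr.ne] at hζ
  have hinv : ContinuousOn (fun ζ : ℂ => (ζ - z)⁻¹) (Metric.sphere z r) :=
    (continuousOn_id.sub continuousOn_const).inv₀ hne
  have hR := continuousOn_resolvent T hres
  have h1 : CircleIntegrable (fun ζ => (ζ - z)⁻¹ • resolvent T ζ) z r :=
    (hinv.smul hR).circleIntegrable hr.le
  have h2 : CircleIntegrable (fun ζ : ℂ => (ζ - z)⁻¹ • (1 : E →L[ℂ] E)) z r :=
    (hinv.smul continuousOn_const).circleIntegrable hr.le
  have hpi : (2 * (Real.pi : ℂ) * Complex.I) ≠ 0 := by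
    simp [Real.pi_ne_zero]
  -- From `R(ζ)(z - T) = 1 - (ζ - z) R(ζ)`, the weight `(ζ - z)⁻¹` turns the integrand into `(ζ -
  -- z)⁻¹ - R(ζ)`; the two terms integrate to the identity and the spectral projection.
  refine ⟨(2 * (Real.pi : ℂ) * Complex.I)⁻¹ • ∮ ζ in C(z, r), (ζ - z)⁻¹ • resolvent T ζ, ?_⟩
  rw [smul_mul_assoc, circleIntegral_mul_const _ _ h1,
    circleIntegral.integral_congr hr.le (g := fun ζ => (ζ - z)⁻¹ • (1 : E →L[ℂ] E) - resolvent T ζ),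
    circleIntegral.integral_sub h2 (hR.circleIntegrable hr.le), circleIntegral.integral_smul_const,
    circleIntegral.integral_sub_center_inv z hr.ne', smul_sub, smul_smul, inv_mul_cancel₀ hpi,
    one_smul, spectralProjection]
  intro ζ hζ
  have h3 : algebraMap ℂ (E →L[ℂ] E) z - T =
      (algebraMap ℂ (E →L[ℂ] E) ζ - T) - (ζ - z) • 1 := by
    rw [Algebra.algebraMap_eq_smul_one, Algebra.algebraMap_eq_smul_one, sub_smul]
    abel
  simp only
  rw [smul_mul_assoc, h3, mul_sub, resolvent_mul_sub (hres hζ), mul_smul_comm, mul_one, smul_sub,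
    smul_smul, inv_mul_cancel₀ (hne ζ hζ), one_smul]

/-- In the resolvent set `K = 0` works; at a discrete spectral value `K` is the spectral projection,
compact because its rank is finite. -/
theorem exists_isCompactOperator_of_notMem_essentialSpectrum (T : E →L[ℂ] E) {z : ℂ}
    (hz : z ∉ essentialSpectrum T) :
    ∃ Q K : E →L[ℂ] E, IsCompactOperator K ∧ Q * (algebraMap ℂ (E →L[ℂ] E) z - T) = 1 - K := by
  by_cases hs : z ∈ spectrum ℂ T
  · have hd : z ∈ discreteSpectrum T := by
      by_contra h
      exact hz ⟨hs, h⟩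
    obtain ⟨-, r, hr, hiso, hfin⟩ := hd
    obtain ⟨Q, hQ⟩ := exists_mul_eq_one_sub_spectralProjection T z hr (fun ζ hζ => by
      by_contra h
      have h1 : ζ ∈ spectrum ℂ T ∩ Metric.closedBall z r := ⟨h, Metric.sphere_subset_closedBall hζ⟩
      rw [hiso, mem_singleton_iff] at h1
      subst h1
      simp [hr.ne] at hζ)
    refine ⟨Q, _, ?_, hQ⟩
    set P := spectralProjection T z r
    have hPc : IsCompactOperator (P.codRestrict (P : E →ₗ[ℂ] E).range
        (fun f => LinearMap.mem_range_self _ f)) := by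
      have : LocallyCompactSpace (P : E →ₗ[ℂ] E).range :=
        .of_finiteDimensional_of_complete ℂ _
      exact isCompactOperator_of_locallyCompactSpace_dom
        (P.codRestrict (P : E →ₗ[ℂ] E).range _)
    exact hPc.clm_comp (P : E →ₗ[ℂ] E).range.subtypeL
  · refine ⟨resolvent T z, 0, isCompactOperator_zero, ?_⟩
    rw [sub_zero]
    exact resolvent_mul_sub (by simpa [spectrum] using hs)

/-- If the projection `p` reduces `T`, with `T = z` on its finite-dimensional range and `z` in the
resolvent set of `T - p`, then `z` is in the discrete spectrum of `T`. -/
theorem mem_discreteSpectrum_of_projection {T p : E →L[ℂ] E} {z : ℂ}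
    (heig : Module.End.HasEigenvalue (T : E →ₗ[ℂ] E) z) (hp : p * p = p)
    (hTp : T * p = z • p) (hpT : p * T = z • p)
    (hfin : FiniteDimensional ℂ (p : E →ₗ[ℂ] E).range) (hz : z ∈ resolventSet ℂ (T - p)) :
    z ∈ discreteSpectrum T := by
  refine ⟨heig, ?_⟩
  obtain ⟨r, hr, hball⟩ := Metric.nhds_basis_closedBall.mem_iff.1
    ((spectrum.isOpen_resolventSet (𝕜 := ℂ) (T - p)).mem_nhds hz)
  set a := algebraMap ℂ (E →L[ℂ] E) with ha
  -- `T` acts as `z` on the range of `p` and agrees with `T - p` on its kernel, so its resolvent is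
  -- the sum of the two partial resolvents.
  have key : ∀ ζ ∈ Metric.closedBall z r, ζ ≠ z →
      (a ζ - T) * (resolvent (T - p) ζ * (1 - p) + (ζ - z)⁻¹ • p) = 1 ∧
      (resolvent (T - p) ζ * (1 - p) + (ζ - z)⁻¹ • p) * (a ζ - T) = 1 := by
    intro ζ hζ hne
    set R := resolvent (T - p) ζ
    have hne' : ζ - z ≠ 0 := sub_ne_zero.2 hne
    have h1 : R * (a ζ - (T - p)) = 1 := resolvent_mul_sub (hball hζ)
    have h2 : (a ζ - (T - p)) * R = 1 := Ring.mul_inverse_cancel _ (hball hζ)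
    have hcomm : Commute (a ζ - (T - p)) p := by
      have hTp' : Commute T p := hTp.trans hpT.symm
      exact (Algebra.commute_algebraMap_left ζ p).sub_left (hTp'.sub_left (Commute.refl p))
    have hRp : p * R = R * p := by
      calc p * R = R * (a ζ - (T - p)) * p * R := by rw [h1, one_mul]
        _ = R * p * ((a ζ - (T - p)) * R) := by
          rw [mul_assoc R, hcomm.eq]; simp only [mul_assoc]
        _ = R * p := by rw [h2, mul_one]
    have hP0 : p * (1 - p) = 0 := by rw [mul_sub, hp, mul_one, sub_self]
    have h3 : a ζ - T = (a ζ - (T - p)) - p := by abel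
    have hap : a ζ * p = ζ • p := by
      rw [ha, Algebra.algebraMap_eq_smul_one, smul_mul_assoc, one_mul]
    have hap' : p * a ζ = ζ • p := by
      rw [ha, Algebra.algebraMap_eq_smul_one, mul_smul_comm, mul_one]
    constructor
    · rw [mul_add]
      have e1 : (a ζ - T) * (R * (1 - p)) = 1 - p := by
        rw [h3, sub_mul, ← mul_assoc, h2, one_mul, ← mul_assoc, hRp, mul_assoc, hP0, mul_zero,
          sub_zero]
      have e2 : (a ζ - T) * ((ζ - z)⁻¹ • p) = p := by
        rw [mul_smul_comm, sub_mul, hap, hTp, ← sub_smul, smul_smul, inv_mul_cancel₀ hne',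
          one_smul]
      rw [e1, e2, sub_add_cancel]
    · rw [add_mul]
      have hc : (1 - p) * (a ζ - T) = (a ζ - T) * (1 - p) := by
        rw [sub_mul 1, one_mul, mul_sub p, mul_sub (a ζ - T), mul_one, sub_mul (a ζ), hap, hap', hTp,
          hpT]
      have e1 : R * (1 - p) * (a ζ - T) = 1 - p := by
        rw [mul_assoc, hc, h3, sub_mul, hP0, sub_zero, ← mul_assoc, h1, one_mul]
      have e2 : ((ζ - z)⁻¹ • p) * (a ζ - T) = p := by
        rw [smul_mul_assoc, mul_sub, hap', hpT, ← sub_smul, smul_smul, inv_mul_cancel₀ hne',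
          one_smul]
      rw [e1, e2, sub_add_cancel]
  have hspec : z ∈ spectrum ℂ T := by
    rw [ContinuousLinearMap.spectrum_eq]
    exact heig.mem_spectrum
  refine ⟨r, hr, ?_, ?_⟩
  · refine Subset.antisymm (fun ζ hζ => ?_) (singleton_subset_iff.2
      ⟨hspec, Metric.mem_closedBall_self hr.le⟩)
    by_contra hne
    obtain ⟨k1, k2⟩ := key ζ hζ.2 hne
    exact hζ.1 (spectrum.mem_resolventSet_of_left_right_inverse k1 k2)
  · have hsub : Metric.sphere z r ⊆ Metric.closedBall z r := Metric.sphere_subset_closedBall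
    have hne : ∀ ζ ∈ Metric.sphere z r, ζ ≠ z := fun ζ hζ h => by
      subst h
      simp [hr.ne] at hζ
    have hinv : ContinuousOn (fun ζ : ℂ => (ζ - z)⁻¹) (Metric.sphere z r) :=
      (continuousOn_id.sub continuousOn_const).inv₀ fun ζ hζ => sub_ne_zero.2 (hne ζ hζ)
    have hR := continuousOn_resolvent (T - p) hball
    -- Cauchy's theorem: the part of the resolvent coming from `T - p` is holomorphic on the disc,
    -- so only the pole `(ζ - z)⁻¹ p` contributes to the spectral projection.
    have h0 : (∮ ζ in C(z, r), resolvent (T - p) ζ) = 0 :=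
      Complex.circleIntegral_eq_zero_of_differentiable_on_off_countable hr.le countable_empty hR
        fun ζ hζ => (spectrum.hasDerivAt_resolvent_const_left
          (hball (Metric.ball_subset_closedBall hζ.1))).differentiableAt
    have hpi : (2 * (Real.pi : ℂ) * Complex.I) ≠ 0 := by
      simp [Real.pi_ne_zero]
    have hRi := (hR.mono hsub).circleIntegrable hr.le
    have hRi' : CircleIntegrable (fun ζ => resolvent (T - p) ζ * (1 - p)) z r :=
      ((hR.mono hsub).mul continuousOn_const).circleIntegrable hr.le
    have hpi' : CircleIntegrable (fun ζ => (ζ - z)⁻¹ • p) z r :=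
      (hinv.smul continuousOn_const).circleIntegrable hr.le
    have hP : spectralProjection T z r = p := by
      rw [spectralProjection, circleIntegral.integral_congr hr.le
        (g := fun ζ => resolvent (T - p) ζ * (1 - p) + (ζ - z)⁻¹ • p),
        circleIntegral.integral_add hRi' hpi', ← circleIntegral_mul_const _ _ hRi, h0, zero_mul, zero_add,
        circleIntegral.integral_smul_const, circleIntegral.integral_sub_center_inv z hr.ne',
        smul_smul, inv_mul_cancel₀ hpi, one_smul]
      intro ζ hζ
      obtain ⟨k1, k2⟩ := key ζ (hsub hζ) (hne ζ hζ)
      exact Ring.inverse_unit ⟨_, _, k1, k2⟩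
    rw [hP]
    exact hfin

end Riesz

/-! ### Projections onto eigenspaces of symmetric operators -/

section Projection

variable {E H : Type*} [NormedAddCommGroup E] [NormedSpace ℂ E] [NormedAddCommGroup H]
  [InnerProductSpace ℂ H]

/-- An operator that is symmetric for the inner product pulled back along `ι` admits a projection
onto a finite-dimensional eigenspace, on which `ι` is injective, that commutes with it. -/
theorem exists_projection_eigenspace {T : E →L[ℂ] E} (ι : E →L[ℂ] H)
    (hsymm : ∀ f g, inner ℂ (ι f) (ι (T g)) = inner ℂ (ι (T f)) (ι g)) {z : ℂ} (hz : z.im = 0)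
    (N : Submodule ℂ E) [FiniteDimensional ℂ N] (hN : ∀ f, f ∈ N ↔ T f = z • f)
    (hι : ∀ f ∈ N, ι f = 0 → f = 0) :
    ∃ p : E →L[ℂ] E, (∀ f, p f ∈ N) ∧ (∀ f ∈ N, p f = f) ∧ ∀ f, p (T f) = z • p f := by
  set i : N →ₗ[ℂ] H := (ι : E →ₗ[ℂ] H) ∘ₗ N.subtype with hi
  have hinj : Function.Injective i := by
    rw [← LinearMap.ker_eq_bot, LinearMap.ker_eq_bot']
    intro f hf
    exact Subtype.ext (hι f f.2 hf)
  set e := LinearEquiv.ofInjective i hinj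
  -- Map into `H` by `ι`, project orthogonally onto the image of `N`, and pull back by the inverse
  -- of `ι` on that image.
  refine ⟨N.subtypeL ∘L (LinearMap.toContinuousLinearMap (e.symm : i.range →ₗ[ℂ] N)) ∘L
    i.range.orthogonalProjectionOnto ∘L ι, fun f => ?_, fun f hf => ?_, fun f => ?_⟩
  · exact Subtype.coe_prop _
  · have h1 : i.range.orthogonalProjectionOnto (ι f) = e ⟨f, hf⟩ :=
      Submodule.orthogonalProjectionOnto_mem_subspace_eq_self (e ⟨f, hf⟩)
    simp [h1]
  -- Symmetry and the reality of `z` make `ι (T f - z f)` orthogonal to the image of the eigenspace.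
  · have h1 : i.range.orthogonalProjectionOnto (ι (T f) - z • ι f) = 0 := by
      rw [Submodule.orthogonalProjectionOnto_eq_zero_iff, Submodule.mem_orthogonal]
      rintro _ ⟨g, rfl⟩
      have h2 : T g = z • (g : E) := (hN g).1 g.2
      have h3 : (starRingEnd ℂ) z = z := Complex.conj_eq_iff_im.2 hz
      change inner ℂ (ι g) _ = 0
      rw [inner_sub_right, hsymm, h2, map_smul, inner_smul_left, inner_smul_right, h3, sub_self]
    rw [map_sub, map_smul, sub_eq_zero] at h1
    simp [h1]

end Projection

/-! ### Compactness, symmetry and spectrum of the kernel operators -/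

theorem continuous_ofReal_kernel {𝒳 𝕜 : Type*} [TopologicalSpace 𝒳] [RCLike 𝕜] (k : C(𝒳 × 𝒳, ℝ)) :
    Continuous fun p : 𝒳 × 𝒳 => ((k p : ℝ) : 𝕜) :=
  RCLike.continuous_ofReal.comp k.continuous

section KernelOperators

variable {𝒳 : Type*} [MetricSpace 𝒳] [CompactSpace 𝒳] [MeasurableSpace 𝒳] [BorelSpace 𝒳]
  {𝕜 : Type*} [RCLike 𝕜] (k : C(𝒳 × 𝒳, ℝ)) (μ : Measure 𝒳) [IsFiniteMeasure μ]

theorem integralOp_apply (f : C(𝒳, 𝕜)) (a : 𝒳) :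
    integralOp 𝕜 k μ f a = ∫ b, (k (a, b) : 𝕜) * f b ∂μ := rfl

theorem lapOp_apply (f : C(𝒳, 𝕜)) (a : 𝒳) :
    lapOp 𝕜 k μ f a = degreeIn 𝕜 k μ a * f a - integralOp 𝕜 k μ f a := rfl

/-- This modulus of continuity depends on `f` only through its norm, which gives equicontinuity on
the unit ball. -/
theorem norm_integralOp_sub_le (f : C(𝒳, 𝕜)) (a b : 𝒳) :
    ‖integralOp 𝕜 k μ f a - integralOp 𝕜 k μ f b‖ ≤
      dist (k.curry a) (k.curry b) * ‖f‖ * μ.real univ := by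
  have hc : ∀ a : 𝒳, Continuous fun c => ((k (a, c) : ℝ) : 𝕜) * f c := fun a =>
    ((continuous_ofReal_kernel k).comp (by fun_prop : Continuous fun c : 𝒳 => (a, c))).mul f.continuous
  rw [integralOp_apply, integralOp_apply, ← integral_sub (integrable_of_continuous μ _ (hc a))
    (integrable_of_continuous μ _ (hc b))]
  refine norm_integral_le_of_norm_le_const (Eventually.of_forall fun c => ?_)
  rw [← sub_mul, norm_mul, ← RCLike.ofReal_sub, RCLike.norm_ofReal]
  refine mul_le_mul ?_ (f.norm_coe_le_norm c) (norm_nonneg _) dist_nonneg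
  exact ContinuousMap.dist_apply_le_dist (f := k.curry a) (g := k.curry b) c

theorem isCompactOperator_integralOp : IsCompactOperator (integralOp ℂ k μ) := by
  refine (isCompactOperator_iff_isCompact_closure_image_ball
    (integralOp ℂ k μ : C(𝒳, ℂ) →ₗ[ℂ] C(𝒳, ℂ)) one_pos).2 ?_
  set Φ := ContinuousMap.isometryEquivBoundedOfCompact 𝒳 ℂ
  rw [← Φ.toHomeomorph.isCompact_image, Φ.toHomeomorph.image_closure]
  refine BoundedContinuousFunction.arzela_ascoli
    (Metric.closedBall 0 ‖integralOp ℂ k μ‖) (isCompact_closedBall _ _) _ ?_ ?_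
  · rintro _ a ⟨_, ⟨f, hf, rfl⟩, rfl⟩
    rw [mem_closedBall_zero_iff]
    rw [mem_ball_zero_iff] at hf
    calc ‖integralOp ℂ k μ f a‖ ≤ ‖integralOp ℂ k μ f‖ := ContinuousMap.norm_coe_le_norm _ _
      _ ≤ ‖integralOp ℂ k μ‖ * ‖f‖ := ContinuousLinearMap.le_opNorm _ _
      _ ≤ _ := mul_le_of_le_one_right (norm_nonneg _) hf.le
  · intro a
    refine Metric.equicontinuousAt_of_continuity_modulus
      (fun b => dist (k.curry a) (k.curry b) * μ.real univ) ?_ _ (Eventually.of_forall ?_)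
    · have : Continuous fun b => dist (k.curry a) (k.curry b) * μ.real univ := by fun_prop
      simpa using this.tendsto a
    · rintro b ⟨_, _, ⟨f, hf, rfl⟩, rfl⟩
      rw [mem_ball_zero_iff] at hf
      rw [dist_eq_norm]
      calc ‖integralOp ℂ k μ f a - integralOp ℂ k μ f b‖
          ≤ dist (k.curry a) (k.curry b) * ‖f‖ * μ.real univ := norm_integralOp_sub_le k μ f a b
        _ ≤ dist (k.curry a) (k.curry b) * μ.real univ := by
          gcongr
          exact mul_le_of_le_one_right dist_nonneg hf.le

theorem lapOp_eq_smul_iff {z : 𝕜} {f : C(𝒳, 𝕜)} :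
    lapOp 𝕜 k μ f = z • f ↔ ∀ a, (degreeIn 𝕜 k μ a - z) * f a = integralOp 𝕜 k μ f a := by
  rw [ContinuousMap.ext_iff]
  refine forall_congr' fun a => ?_
  rw [lapOp_apply, ContinuousMap.smul_apply, smul_eq_mul]
  constructor <;> intro h <;> linear_combination h

theorem integralOp_eq_zero_of_toLp_eq_zero {f : C(𝒳, 𝕜)}
    (hf : ContinuousMap.toLp (E := 𝕜) 2 μ 𝕜 f = 0) : integralOp 𝕜 k μ f = 0 := by
  have h : f =ᵐ[μ] 0 := by
    have h1 := ContinuousMap.coeFn_toLp (p := 2) (𝕜 := 𝕜) μ f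
    rw [hf] at h1
    exact h1.symm.trans (Lp.coeFn_zero 𝕜 2 μ)
  ext a
  rw [integralOp_apply, ContinuousMap.zero_apply]
  refine integral_eq_zero_of_ae ?_
  filter_upwards [h] with b hb
  simp [hb]

variable {k}

/-- Fubini's theorem together with the symmetry of the real kernel. -/
theorem inner_integralOp (hk : ∀ a b, k (a, b) = k (b, a)) (f g : C(𝒳, ℂ)) :
    ∫ a, integralOp ℂ k μ g a * starRingEnd ℂ (f a) ∂μ =
      ∫ a, g a * starRingEnd ℂ (integralOp ℂ k μ f a) ∂μ := by
  have hc : Continuous (Function.uncurry fun a b : 𝒳 =>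
      RCLike.ofReal (K := ℂ) (k (a, b)) * g b * starRingEnd ℂ (f a)) := by
    have := continuous_ofReal_kernel (𝕜 := ℂ) k
    exact (this.mul (g.continuous.comp continuous_snd)).mul
      (Complex.continuous_conj.comp (f.continuous.comp continuous_fst))
  have hswap := integral_integral_swap_of_hasCompactSupport hc (HasCompactSupport.of_compactSpace _)
    (μ := μ) (ν := μ)
  calc _ = ∫ a, ∫ b, RCLike.ofReal (K := ℂ) (k (a, b)) * g b * starRingEnd ℂ (f a) ∂μ ∂μ := by
        refine integral_congr_ae (Eventually.of_forall fun a => ?_)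
        exact (integral_mul_const _ _).symm
    _ = _ := hswap
    _ = _ := by
        refine integral_congr_ae (Eventually.of_forall fun b => ?_)
        simp only [integralOp_apply, ← integral_conj, ← integral_const_mul]
        refine integral_congr_ae (Eventually.of_forall fun a => ?_)
        simp only [map_mul, hk a b]
        rw [RCLike.conj_ofReal]
        ring

theorem inner_lapOp (hk : ∀ a b, k (a, b) = k (b, a)) (f g : C(𝒳, ℂ)) :
    inner ℂ (ContinuousMap.toLp (E := ℂ) 2 μ ℂ f)
        (ContinuousMap.toLp (E := ℂ) 2 μ ℂ (lapOp ℂ k μ g)) =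
      inner ℂ (ContinuousMap.toLp (E := ℂ) 2 μ ℂ (lapOp ℂ k μ f))
        (ContinuousMap.toLp (E := ℂ) 2 μ ℂ g) := by
  rw [ContinuousMap.inner_toLp, ContinuousMap.inner_toLp]
  have hconj : ∀ h : C(𝒳, ℂ), Continuous fun a => starRingEnd ℂ (h a) := fun h =>
    Complex.continuous_conj.comp h.continuous
  have h1 : Integrable (fun a => degreeIn ℂ k μ a * g a * starRingEnd ℂ (f a)) μ :=
    integrable_of_continuous μ _
      (((degreeIn ℂ k μ).continuous.mul g.continuous).mul (hconj f))
  have h2 : Integrable (fun a => integralOp ℂ k μ g a * starRingEnd ℂ (f a)) μ :=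
    integrable_of_continuous μ _ ((integralOp ℂ k μ g).continuous.mul (hconj f))
  have h3 : Integrable (fun a => g a * starRingEnd ℂ (integralOp ℂ k μ f a)) μ :=
    integrable_of_continuous μ _ (g.continuous.mul (hconj _))
  calc _ = ∫ a, (degreeIn ℂ k μ a * g a * starRingEnd ℂ (f a) -
          integralOp ℂ k μ g a * starRingEnd ℂ (f a)) ∂μ := by
        simp only [lapOp_apply, sub_mul]
    _ = ∫ a, (degreeIn ℂ k μ a * g a * starRingEnd ℂ (f a) -
          g a * starRingEnd ℂ (integralOp ℂ k μ f a)) ∂μ := by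
        rw [integral_sub h1 h2, integral_sub h1 h3, inner_integralOp μ hk]
    _ = _ := by
        refine integral_congr_ae (Eventually.of_forall fun a => ?_)
        have h4 : starRingEnd ℂ (degreeIn ℂ k μ a) = degreeIn ℂ k μ a :=
          Complex.conj_ofReal _
        simp only [lapOp_apply, map_sub, map_mul, h4]
        ring

variable {μ}

/-- If `f` vanishes almost everywhere, then `S f = 0` everywhere, so `(d - z) f = 0` with `d - z`
nowhere zero. This replaces the assumption that `μ` has full support. -/
theorem eq_zero_of_lapOp_eq_smul_of_toLp_eq_zero {z : 𝕜} (hz : z ∉ range (degreeIn 𝕜 k μ))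
    {f : C(𝒳, 𝕜)} (hf : lapOp 𝕜 k μ f = z • f) (h0 : ContinuousMap.toLp (E := 𝕜) 2 μ 𝕜 f = 0) : f = 0 := by
  ext a
  have h := (lapOp_eq_smul_iff k μ).1 hf a
  rw [integralOp_eq_zero_of_toLp_eq_zero k μ h0, ContinuousMap.zero_apply] at h
  exact (mul_eq_zero.1 h).resolve_left (sub_ne_zero.2 fun h' => hz ⟨a, h'⟩)

/-- Values of `d` are real anyway; off its range `f` is nonzero in `L²(μ)` and the usual argument
for symmetric operators applies. -/
theorem im_eq_zero_of_lapOp_eq_smul (hk : ∀ a b, k (a, b) = k (b, a)) {z : ℂ} {f : C(𝒳, ℂ)}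
    (hf : lapOp ℂ k μ f = z • f) (hf0 : f ≠ 0) : z.im = 0 := by
  by_cases hz : z ∈ range (degreeIn ℂ k μ)
  · obtain ⟨a, rfl⟩ := hz
    exact Complex.ofReal_im _
  · have h0 : ContinuousMap.toLp (E := ℂ) 2 μ ℂ f ≠ 0 := fun h =>
      hf0 (eq_zero_of_lapOp_eq_smul_of_toLp_eq_zero hz hf h)
    have h := inner_lapOp μ hk f f
    rw [hf, map_smul, inner_smul_left, inner_smul_right] at h
    exact Complex.conj_eq_iff_im.1 (mul_right_cancel₀ (inner_self_ne_zero.2 h0) h).symm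

/-- At a maximum `a` of `|f|` the equation gives `|d(a) - z| |f(a)| ≤ d(a) |f(a)|`, hence `d(a) - Re
z ≤ d(a)`. -/
theorem re_nonneg_of_lapOp_eq_smul (hk : ∀ a b, 0 ≤ k (a, b)) {z : ℂ} {f : C(𝒳, ℂ)}
    (hf : lapOp ℂ k μ f = z • f) (hf0 : f ≠ 0) : 0 ≤ z.re := by
  obtain ⟨b, hb⟩ : ∃ b, f b ≠ 0 := by
    by_contra! h
    exact hf0 (ContinuousMap.ext h)
  have : Nonempty 𝒳 := ⟨b⟩
  obtain ⟨a, -, ha⟩ := isCompact_univ.exists_isMaxOn univ_nonempty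
    (f.continuous.norm.continuousOn (s := univ))
  have hmax : ∀ c, ‖f c‖ ≤ ‖f a‖ := fun c => ha (mem_univ c)
  have hpos : 0 < ‖f a‖ := (norm_pos_iff.2 hb).trans_le (hmax b)
  have h1 : ‖integralOp ℂ k μ f a‖ ≤ degree k μ a * ‖f a‖ := by
    have hka : Continuous fun c => k (a, c) := by fun_prop
    calc ‖integralOp ℂ k μ f a‖ ≤ ∫ c, k (a, c) * ‖f a‖ ∂μ := by
          rw [integralOp_apply]
          refine norm_integral_le_of_norm_le
            (integrable_of_continuous μ _ (hka.mul continuous_const))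
            (Eventually.of_forall fun c => ?_)
          rw [norm_mul, RCLike.norm_ofReal, abs_of_nonneg (hk a c)]
          exact mul_le_mul_of_nonneg_left (hmax c) (hk a c)
      _ = degree k μ a * ‖f a‖ := integral_mul_const _ _
  rw [← (lapOp_eq_smul_iff k μ).1 hf a, norm_mul] at h1
  have h2 := (Complex.re_le_norm _).trans (le_of_mul_le_mul_right h1 hpos)
  have h3 : (degreeIn ℂ k μ a - z).re = degree k μ a - z.re := by
    rw [Complex.sub_re]
    exact congrArg (· - z.re) (Complex.ofReal_re _)
  rw [h3] at h2
  linarith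

theorem isUnit_algebraMap_sub_mulOp {z : ℂ} (hz : z ∉ range (degreeIn ℂ k μ)) :
    IsUnit (algebraMap ℂ (C(𝒳, ℂ) →L[ℂ] C(𝒳, ℂ)) z - mulOp ℂ k μ) := by
  have hu : IsUnit (algebraMap ℂ C(𝒳, ℂ) z - degreeIn ℂ k μ) := by
    rw [ContinuousMap.isUnit_iff_forall_ne_zero]
    intro a
    exact sub_ne_zero.2 fun h => hz ⟨a, h.symm⟩
  obtain ⟨u, hu⟩ := hu
  have h1 : algebraMap ℂ (C(𝒳, ℂ) →L[ℂ] C(𝒳, ℂ)) z - mulOp ℂ k μ =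
      ContinuousLinearMap.mul ℂ C(𝒳, ℂ) u := by
    rw [hu, map_sub, mulOp]
    congr 1
  rw [h1]
  refine ⟨⟨_, ContinuousLinearMap.mul ℂ C(𝒳, ℂ) ↑u⁻¹, ?_, ?_⟩, rfl⟩ <;>
  · refine ContinuousLinearMap.ext fun f => ?_
    simp

theorem mem_discreteSpectrum_lapOp (hk : ∀ a b, k (a, b) = k (b, a)) {z : ℂ}
    (hs : z ∈ spectrum ℂ (lapOp ℂ k μ)) (hz : z ∉ range (degreeIn ℂ k μ)) :
    z ∈ discreteSpectrum (lapOp ℂ k μ) := by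
  set T := lapOp ℂ k μ with hT
  set B := algebraMap ℂ (C(𝒳, ℂ) →L[ℂ] C(𝒳, ℂ)) z - mulOp ℂ k μ with hB
  have hBu : IsUnit B := isUnit_algebraMap_sub_mulOp hz
  have hS := isCompactOperator_integralOp k μ
  have hzT : algebraMap ℂ (C(𝒳, ℂ) →L[ℂ] C(𝒳, ℂ)) z - T = B - -integralOp ℂ k μ := by
    rw [hT, hB, lapOp]
    abel
  have hker : ∀ f, (B - -integralOp ℂ k μ) f = 0 ↔ T f = z • f := fun f => by
    rw [← hzT]
    simp only [Algebra.algebraMap_eq_smul_one, sub_apply, smul_apply, one_apply_eq_self]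
    rw [sub_eq_zero, eq_comm]
  obtain ⟨f₀, hf₀, hf₀'⟩ : ∃ f, T f = z • f ∧ f ≠ 0 := by
    by_contra! h
    exact hs (by
      have := isUnit_sub_of_injective hBu hS.neg fun f hf => h f ((hker f).1 hf)
      rwa [← hzT] at this)
  set N := (B - -integralOp ℂ k μ : C(𝒳, ℂ) →L[ℂ] C(𝒳, ℂ)).ker
  have hN : ∀ f, f ∈ N ↔ T f = z • f := hker
  have : FiniteDimensional ℂ N := finiteDimensional_of_forall_sub_eq_zero hBu hS.neg N
    (ContinuousLinearMap.isClosed_ker _) fun f hf => hf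
  obtain ⟨p, hpN, hpid, hpT⟩ := exists_projection_eigenspace (T := T)
    (ContinuousMap.toLp (E := ℂ) 2 μ ℂ) (inner_lapOp μ hk)
    (im_eq_zero_of_lapOp_eq_smul hk hf₀ hf₀') N hN
    fun f hf h0 => eq_zero_of_lapOp_eq_smul_of_toLp_eq_zero hz ((hN f).1 hf) h0
  have hpp : p * p = p := ContinuousLinearMap.ext fun f => hpid _ (hpN f)
  have hTp : T * p = z • p := ContinuousLinearMap.ext fun f => (hN _).1 (hpN f)
  have hpT' : p * T = z • p := ContinuousLinearMap.ext hpT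
  have hrange : (p : C(𝒳, ℂ) →ₗ[ℂ] C(𝒳, ℂ)).range ≤ N := by
    rintro _ ⟨f, rfl⟩
    exact hpN f
  have hfin : FiniteDimensional ℂ (p : C(𝒳, ℂ) →ₗ[ℂ] C(𝒳, ℂ)).range :=
    Submodule.finiteDimensional_of_le hrange
  have hpc : IsCompactOperator p := by
    have : LocallyCompactSpace N := .of_finiteDimensional_of_complete ℂ _
    exact (isCompactOperator_of_locallyCompactSpace_dom (p.codRestrict N hpN)).clm_comp N.subtypeL
  refine mem_discreteSpectrum_of_projection ?_ hpp hTp hpT' hfin ?_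
  · exact Module.End.hasEigenvalue_of_hasEigenvector
      ⟨Module.End.mem_eigenspace_iff.2 hf₀, hf₀'⟩
  · have h1 : algebraMap ℂ (C(𝒳, ℂ) →L[ℂ] C(𝒳, ℂ)) z - (T - p) =
        B - (-integralOp ℂ k μ - p) := by
      rw [← sub_add, hzT]
      abel
    rw [spectrum.mem_resolventSet_iff, h1]
    refine isUnit_sub_of_injective hBu (hS.neg.sub hpc) fun f hf => ?_
    rw [← h1] at hf
    have h2 : z • f - (T f - p f) = 0 := by
      simpa [Algebra.algebraMap_eq_smul_one] using hf
    -- Applying `p` to the equation cancels the terms in `z` and leaves `p f = 0`; then `f` lies in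
    -- `N`, where `p` is the identity.
    have h3 : p f = 0 := by
      have := congrArg p h2
      rw [map_sub, map_sub, map_smul, hpT, hpid _ (hpN f), map_zero] at this
      simpa using this
    rw [h3, sub_zero, sub_eq_zero] at h2
    rw [← hpid f ((hN f).2 h2.symm), h3]

theorem essentialSpectrum_lapOp_subset (hk : ∀ a b, k (a, b) = k (b, a)) :
    essentialSpectrum (lapOp ℂ k μ) ⊆ range (degreeIn ℂ k μ) := fun z hz => by
  by_contra h
  exact hz.2 (mem_discreteSpectrum_lapOp hk hz.1 h)

/-- The spectrum is closed, so an accumulation point of eigenvalues is a spectral value, and it is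
not isolated in the spectrum; off the range of `d` every spectral value is. -/
theorem mem_range_degreeIn_of_accPt (hk : ∀ a b, k (a, b) = k (b, a)) {z : ℂ}
    (hz : AccPt z (𝓟 (eigenvalueSet (lapOp ℂ k μ)))) : z ∈ range (degreeIn ℂ k μ) := by
  by_contra h
  have hsub : eigenvalueSet (lapOp ℂ k μ) ⊆ spectrum ℂ (lapOp ℂ k μ) := fun w hw => by
    rw [ContinuousLinearMap.spectrum_eq]
    exact Module.End.HasEigenvalue.mem_spectrum hw
  have hacc : AccPt z (𝓟 (spectrum ℂ (lapOp ℂ k μ))) := hz.mono (principal_mono.2 hsub)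
  have hs : z ∈ spectrum ℂ (lapOp ℂ k μ) :=
    (spectrum.isClosed (𝕜 := ℂ) (lapOp ℂ k μ)).closure_subset_iff.2 subset_rfl
      (mem_closure_iff_clusterPt.2 hacc.clusterPt)
  obtain ⟨-, r, hr, hiso, -⟩ := mem_discreteSpectrum_lapOp hk hs h
  obtain ⟨w, ⟨hw, hws⟩, hne⟩ := accPt_iff_nhds.1 hacc _ (Metric.closedBall_mem_nhds z hr)
  have : w ∈ spectrum ℂ (lapOp ℂ k μ) ∩ Metric.closedBall z r := ⟨hws, hw⟩
  rw [hiso] at this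
  exact hne this

end KernelOperators

/-! ### Bump functions concentrating at a non-isolated point -/

section Bumps

variable {𝒳 : Type*} [MetricSpace 𝒳]

/-- A non-isolated point is the limit of a sequence that at least halves its distance to the point
in each step. -/
theorem exists_seq_dist_lt_half {a : 𝒳} (ha : ¬ IsOpen ({a} : Set 𝒳)) :
    ∃ x : ℕ → 𝒳, (∀ m, 0 < dist (x m) a) ∧ (∀ m, dist (x m) a ≤ (1 / 2) ^ m) ∧
      ∀ m j, m < j → dist (x j) a < dist (x m) a / 2 := by
  -- The condition `0 < ε` sits inside the existential so that the choice is a function on all of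
  -- `ℝ`, with default value `a`.
  have hpick : ∀ ε : ℝ, ∃ y, 0 < ε → 0 < dist y a ∧ dist y a < ε := fun ε => by
    by_cases hε : 0 < ε
    · by_contra! h
      refine ha (Metric.isOpen_singleton_iff.2 ⟨ε, hε, fun y hy => ?_⟩)
      by_contra hne
      exact absurd hy (not_lt.2 ((h y).2 (dist_pos.2 hne)))
    · exact ⟨a, fun h => absurd h hε⟩
  choose pick hp using hpick
  set x : ℕ → 𝒳 := fun m => Nat.rec (pick 1) (fun _ y => pick (dist y a / 2)) m with hx
  have hsucc : ∀ m, x (m + 1) = pick (dist (x m) a / 2) := fun m => rfl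
  have hpos : ∀ m, 0 < dist (x m) a := fun m => by
    induction m with
    | zero => exact (hp 1 one_pos).1
    | succ m ih =>
      rw [hsucc]
      exact (hp _ (half_pos ih)).1
  have hhalf : ∀ m, dist (x (m + 1)) a < dist (x m) a / 2 := fun m => by
    rw [hsucc]
    exact (hp _ (half_pos (hpos m))).2
  refine ⟨x, hpos, fun m => ?_, fun m j hmj => ?_⟩
  · induction m with
    | zero =>
      rw [pow_zero]
      exact (hp 1 one_pos).2.le
    | succ m ih =>
      rw [pow_succ]
      linarith [hhalf m]
  · induction j, hmj using Nat.le_induction with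
    | base => exact hhalf m
    | succ j _ ih => linarith [hhalf j, hpos j]

/-- The functions are tents of height one at points `x m → a`, with radius half the distance to `a`.
Later points lie outside earlier tents, and the supports shrink to `a`, where `g` vanishes. -/
theorem exists_separated_seq_mul_tendsto_zero [CompactSpace 𝒳] {a : 𝒳}
    (ha : ¬ IsOpen ({a} : Set 𝒳)) (g : C(𝒳, ℂ)) (hg : g a = 0) :
    ∃ f : ℕ → C(𝒳, ℂ), (∀ m, ‖f m‖ ≤ 1) ∧ (∀ m j, m < j → 1 ≤ ‖f m - f j‖) ∧
      Tendsto (fun m => g * f m) atTop (𝓝 0) := by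
  obtain ⟨x, hpos, hle, hlt⟩ := exists_seq_dist_lt_half ha
  set φ : ℕ → 𝒳 → ℝ := fun m y => max 0 (1 - dist y (x m) / (dist (x m) a / 2)) with hφ
  have hφ0 : ∀ m y, 0 ≤ φ m y := fun m y => le_max_left _ _
  have hφ1 : ∀ m y, φ m y ≤ 1 := fun m y => by
    have := hpos m
    exact max_le zero_le_one (sub_le_self _ (by positivity))
  have hφs : ∀ m y, dist (x m) a / 2 ≤ dist y (x m) → φ m y = 0 := fun m y h => by
    refine max_eq_left ?_
    rw [sub_nonpos, one_le_div (half_pos (hpos m))]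
    exact h
  have hφx : ∀ m, φ m (x m) = 1 := fun m => by simp [hφ]
  set f : ℕ → C(𝒳, ℂ) := fun m =>
    ⟨fun y => (φ m y : ℂ), Complex.continuous_ofReal.comp (by fun_prop)⟩ with hf
  have hfa : ∀ m y, f m y = (φ m y : ℂ) := fun m y => rfl
  have hfn : ∀ m y, ‖f m y‖ ≤ 1 := fun m y => by
    rw [hfa, Complex.norm_real, Real.norm_eq_abs, abs_of_nonneg (hφ0 m y)]
    exact hφ1 m y
  refine ⟨f, fun m => (ContinuousMap.norm_le _ zero_le_one).2 (hfn m), fun m j hmj => ?_, ?_⟩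
  · have h0 : φ m (x j) = 0 := by
      refine hφs m _ ?_
      have h1 := dist_triangle_left (x m) a (x j)
      linarith [hlt m j hmj]
    have h1 := (f m - f j).norm_coe_le_norm (x j)
    simpa [hfa, h0, hφx j] using h1
  · rw [Metric.tendsto_atTop]
    intro ε hε
    obtain ⟨δ, hδ, hgδ⟩ := Metric.continuousAt_iff.1 g.continuous.continuousAt (ε / 2) (half_pos hε)
    -- Points of the tent lie within `3/2 · dist (x m) a` of `a`, and `3/2 · δ/2 < δ`.
    obtain ⟨M, hM⟩ := exists_pow_lt_of_lt_one (half_pos hδ) (by norm_num : (1 / 2 : ℝ) < 1)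
    refine ⟨M, fun m hm => ?_⟩
    rw [dist_zero_right]
    refine lt_of_le_of_lt ((ContinuousMap.norm_le _ (half_pos hε).le).2 fun y => ?_) (half_lt_self hε)
    rw [ContinuousMap.mul_apply, norm_mul]
    by_cases hy : dist (x m) a / 2 ≤ dist y (x m)
    · rw [hfa, hφs m y hy]
      simp [(half_pos hε).le]
    · have h1 : dist y a < δ := by
        have h2 : (1 / 2 : ℝ) ^ m ≤ (1 / 2) ^ M :=
          pow_le_pow_of_le_one (by norm_num) (by norm_num) hm
        have h3 := dist_triangle y (x m) a
        have h4 := hle m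
        have h5 := hpos m
        linarith
      have h2 := hgδ h1
      rw [hg, dist_zero_right] at h2
      calc ‖g y‖ * ‖f m y‖ ≤ ‖g y‖ := mul_le_of_le_one_right (norm_nonneg _) (hfn m y)
        _ ≤ ε / 2 := h2.le

end Bumps

/-! ### The range of the degree function lies in the essential spectrum -/

section EssentialSpectrumOfLaplacian

variable {𝒳 : Type*} [MetricSpace 𝒳] [CompactSpace 𝒳] [MeasurableSpace 𝒳] [BorelSpace 𝒳]

theorem range_degreeIn_subset_essentialSpectrum (hX : ∀ a : 𝒳, ¬ IsOpen ({a} : Set 𝒳))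
    (k : C(𝒳 × 𝒳, ℝ)) (μ : Measure 𝒳) [IsFiniteMeasure μ] :
    range (degreeIn ℂ k μ) ⊆ essentialSpectrum (lapOp ℂ k μ) := by
  rintro _ ⟨a, rfl⟩
  by_contra hz
  set z := degreeIn ℂ k μ a with hza
  obtain ⟨Q, K, hK, hQ⟩ := exists_isCompactOperator_of_notMem_essentialSpectrum _ hz
  set B := algebraMap ℂ (C(𝒳, ℂ) →L[ℂ] C(𝒳, ℂ)) z - mulOp ℂ k μ with hB
  -- Passing from `z - U` to `z - M_d` subtracts the compact operator `S`, so the same `Q` is a left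
  -- inverse modulo compacts.
  have hQB : Q * B = 1 - (K + Q * integralOp ℂ k μ) := by
    have h : B = (algebraMap ℂ (C(𝒳, ℂ) →L[ℂ] C(𝒳, ℂ)) z - lapOp ℂ k μ) - integralOp ℂ k μ := by
      rw [hB, lapOp]
      abel
    rw [h, mul_sub, hQ]
    abel
  obtain ⟨f, hf1, hf2, hf3⟩ := exists_separated_seq_mul_tendsto_zero (hX a)
    (algebraMap ℂ C(𝒳, ℂ) z - degreeIn ℂ k μ) (by
      simp [hza])
  refine not_tendsto_zero_of_mul_eq_one_sub
    (hK.add ((isCompactOperator_integralOp k μ).clm_comp Q)) hQB f hf1 hf2 ?_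
  refine hf3.congr fun m => ?_
  rw [hB, sub_mul, ← Algebra.smul_def]
  simp [Algebra.algebraMap_eq_smul_one, mulOp]

end EssentialSpectrumOfLaplacian

/-! ### Eigenfunctions of the empirical operator and the graph Laplacian -/

section Empirical

variable {𝒳 : Type*} [MetricSpace 𝒳] [CompactSpace 𝒳] [MeasurableSpace 𝒳] [BorelSpace 𝒳] {n : ℕ}
  {𝕜 : Type*} [RCLike 𝕜] (k : C(𝒳 × 𝒳, ℝ)) (X : Fin n → 𝒳)

theorem integral_empiricalMeasure {F : Type*} [NormedAddCommGroup F] [NormedSpace ℝ F]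
    [CompleteSpace F] {g : 𝒳 → F} (hg : Continuous g) :
    ∫ b, g b ∂(empiricalMeasure X) = (n : ℝ)⁻¹ • ∑ j, g (X j) := by
  rw [empiricalMeasure, integral_smul_nnreal_measure,
    integral_finsetSum_measure fun j _ => integrable_of_continuous _ g hg]
  simp only [integral_dirac, NNReal.smul_def, NNReal.coe_inv, NNReal.coe_natCast]

theorem integralOp_empiricalMeasure_apply (f : C(𝒳, 𝕜)) (a : 𝒳) :
    integralOp 𝕜 k (empiricalMeasure X) f a = (n : 𝕜)⁻¹ * ∑ j, (k (a, X j) : 𝕜) * f (X j) := by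
  have hc : Continuous fun b => ((k (a, b) : ℝ) : 𝕜) * f b :=
    ((continuous_ofReal_kernel k).comp (by fun_prop : Continuous fun c : 𝒳 => (a, c))).mul
      f.continuous
  rw [integralOp_apply, integral_empiricalMeasure X hc, RCLike.real_smul_eq_coe_mul]
  simp

theorem empDegree_apply (a : 𝒳) :
    empDegree 𝕜 k X a = (n : 𝕜)⁻¹ * ∑ j, (k (a, X j) : 𝕜) := by
  change ((∫ b, k (a, b) ∂(empiricalMeasure X) : ℝ) : 𝕜) = _
  rw [integral_empiricalMeasure X (by fun_prop)]
  simp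

theorem scaledLaplacian_apply (v : Fin n → 𝕜) (i : Fin n) :
    scaledLaplacian 𝕜 k X v i =
      empDegree 𝕜 k X (X i) * v i - (n : 𝕜)⁻¹ * ∑ j, (k (X i, X j) : 𝕜) * v j := by
  have h : ∀ j, ((((n : ℝ)⁻¹) • graphLaplacian k X).map (fun t : ℝ => (t : 𝕜))) i j =
      (n : 𝕜)⁻¹ * ((if i = j then ∑ l, (k (X i, X l) : 𝕜) else 0) - (k (X i, X j) : 𝕜)) := by
    intro j
    simp only [graphLaplacian, degMatrix, simMatrix, Matrix.map_apply, Matrix.smul_apply,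
      Matrix.sub_apply, Matrix.diagonal_apply, Matrix.of_apply, smul_eq_mul]
    split_ifs <;> simp
  simp only [scaledLaplacian, Matrix.toLin'_apply, Matrix.mulVec, dotProduct, h, mul_assoc, sub_mul,
    ite_mul, zero_mul, ← Finset.mul_sum, Finset.sum_sub_distrib, Finset.sum_ite_eq,
    Finset.mem_univ, if_true, empDegree_apply]
  ring

theorem scaledLaplacian_sampleRestrict (f : C(𝒳, 𝕜)) :
    scaledLaplacian 𝕜 k X (sampleRestrict X f) = sampleRestrict X (empLapOp 𝕜 k X f) := by
  ext i
  rw [scaledLaplacian_apply]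
  change _ = lapOp 𝕜 k (empiricalMeasure X) f (X i)
  rw [lapOp_apply, integralOp_empiricalMeasure_apply]
  rfl

theorem empLapOp_eq_smul_iff {z : 𝕜} {f : C(𝒳, 𝕜)} :
    empLapOp 𝕜 k X f = z • f ↔ ∀ a, (empDegree 𝕜 k X a - z) * f a =
      (n : 𝕜)⁻¹ * ∑ j, (k (a, X j) : 𝕜) * sampleRestrict X f j := by
  rw [empLapOp, lapOp_eq_smul_iff]
  refine forall_congr' fun a => ?_
  rw [integralOp_empiricalMeasure_apply]
  rfl

theorem isEigenvector_iff {E : Type*} [NormedAddCommGroup E] [NormedSpace 𝕜 E] {T : E →L[𝕜] E}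
    {z : 𝕜} {f : E} : IsEigenvector T z f ↔ T f = z • f ∧ f ≠ 0 := by
  rw [IsEigenvector, Module.End.hasEigenvector_iff, Module.End.mem_eigenspace_iff]
  rfl

variable {k X}

theorem scaledLaplacian_sampleRestrict_eq_smul {z : 𝕜} {f : C(𝒳, 𝕜)}
    (hf : empLapOp 𝕜 k X f = z • f) :
    scaledLaplacian 𝕜 k X (sampleRestrict X f) = z • sampleRestrict X f := by
  rw [scaledLaplacian_sampleRestrict, hf]
  rfl

/-- If all sample values vanished, the equation at `a` would read `(d_n(a) - z) f(a) = 0`. -/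
theorem sampleRestrict_ne_zero {z : 𝕜} {f : C(𝒳, 𝕜)} (hf : empLapOp 𝕜 k X f = z • f) {a : 𝒳}
    (ha : f a ≠ 0) (hz : empDegree 𝕜 k X a ≠ z) : sampleRestrict X f ≠ 0 := fun h => by
  have h1 := (empLapOp_eq_smul_iff k X).1 hf a
  rw [h] at h1
  simp [sub_ne_zero.2 hz, ha] at h1

theorem eq_extension_sampleRestrict {z : 𝕜} {f : C(𝒳, 𝕜)} (hf : empLapOp 𝕜 k X f = z • f) {a : 𝒳}
    (hz : empDegree 𝕜 k X a ≠ z) : f a = extension k X z (sampleRestrict X f) a := by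
  rw [extension, eq_div_iff (sub_ne_zero.2 hz), mul_comm, (empLapOp_eq_smul_iff k X).1 hf a]

theorem continuous_extension {z : 𝕜} (hz : z ∉ range (empDegree 𝕜 k X)) (v : Fin n → 𝕜) :
    Continuous (extension k X z v) := by
  refine Continuous.div (continuous_const.mul (continuous_finsetSum _ fun j _ => ?_))
    ((empDegree 𝕜 k X).continuous.sub continuous_const) fun a h => hz ⟨a, sub_eq_zero.1 h⟩
  exact ((continuous_ofReal_kernel k).comp
    (by fun_prop : Continuous fun a : 𝒳 => (a, X j))).mul continuous_const

/-- The `i`-th row of the matrix eigenvalue equation, solved for `v i`, is the extension formula at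
`X i`. -/
theorem sampleRestrict_extension {z : 𝕜} {v : Fin n → 𝕜} (hz : z ∉ range (empDegree 𝕜 k X))
    (hv : scaledLaplacian 𝕜 k X v = z • v) (i : Fin n) : extension k X z v (X i) = v i := by
  have h1 := congrFun hv i
  rw [scaledLaplacian_apply, Pi.smul_apply, smul_eq_mul] at h1
  rw [extension, div_eq_iff (sub_ne_zero.2 fun h => hz ⟨X i, h⟩)]
  linear_combination -h1

theorem exists_isEigenvector_extension {z : 𝕜} {v : Fin n → 𝕜}
    (hz : z ∉ range (empDegree 𝕜 k X)) (hv : scaledLaplacian 𝕜 k X v = z • v) (hv0 : v ≠ 0) :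
    ∃ f : C(𝒳, 𝕜), (∀ a, f a = extension k X z v a) ∧
      IsEigenvector (empLapOp 𝕜 k X) z f ∧ sampleRestrict X f = v := by
  have hr : sampleRestrict X ⟨extension k X z v, continuous_extension hz v⟩ = v :=
    funext fun i => sampleRestrict_extension hz hv i
  refine ⟨⟨extension k X z v, continuous_extension hz v⟩, fun a => rfl,
    isEigenvector_iff.2 ⟨?_, fun h => hv0 ?_⟩, hr⟩
  · rw [empLapOp_eq_smul_iff, hr]
    intro a
    exact mul_div_cancel₀ _ (sub_ne_zero.2 fun h => hz ⟨a, h⟩)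
  · rw [← hr, h]
    rfl

end Empirical

/-! ### Spectral statements for an arbitrary finite measure -/

section SpectralProperties

variable {𝒳 : Type*} [MetricSpace 𝒳] [CompactSpace 𝒳] [MeasurableSpace 𝒳] [BorelSpace 𝒳]

theorem essentialSpectrum_and_eigenvalues_lapOp (k : C(𝒳 × 𝒳, ℝ)) (hsymm : ∀ a b, k (a, b) = k (b, a))
    (hpos : ∀ a b, 0 ≤ k (a, b)) (μ : Measure 𝒳) [IsFiniteMeasure μ] :
    essentialSpectrum (lapOp ℂ k μ) ⊆ Set.range (degreeIn ℂ k μ) ∧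
      ((∀ a : 𝒳, ¬ IsOpen ({a} : Set 𝒳)) →
        essentialSpectrum (lapOp ℂ k μ) = Set.range (degreeIn ℂ k μ)) ∧
      (∀ z ∈ eigenvalueSet (lapOp ℂ k μ), z.im = 0 ∧ 0 ≤ z.re) ∧
      (∀ z : ℂ, AccPt z (Filter.principal (eigenvalueSet (lapOp ℂ k μ))) →
        z ∈ Set.range (degreeIn ℂ k μ)) := by
  refine ⟨essentialSpectrum_lapOp_subset hsymm, fun hX =>
    (essentialSpectrum_lapOp_subset hsymm).antisymm
      (range_degreeIn_subset_essentialSpectrum hX k μ), fun z hz => ?_,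
    fun z hz => mem_range_degreeIn_of_accPt hsymm hz⟩
  obtain ⟨f, hf⟩ := Module.End.HasEigenvalue.exists_hasEigenvector hz
  obtain ⟨h1, h2⟩ := isEigenvector_iff.1 hf
  exact ⟨im_eq_zero_of_lapOp_eq_smul hsymm h1 h2, re_nonneg_of_lapOp_eq_smul hpos h1 h2⟩

end SpectralProperties

end SpectralClustering

theorem proposition22
    {𝒳 : Type*} [MetricSpace 𝒳] [CompactSpace 𝒳] [MeasurableSpace 𝒳] [BorelSpace 𝒳]
    (P : MeasureTheory.Measure 𝒳) [MeasureTheory.IsProbabilityMeasure P]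
    (k : C(𝒳 × 𝒳, ℝ)) (hsymm : ∀ a b, k (a, b) = k (b, a))
    (hpos : ∃ l : ℝ, 0 < l ∧ ∀ a b, l < k (a, b))
    (n : ℕ) (hn : 1 ≤ n) (X : Fin n → 𝒳)
    (𝕜 : Type*) [RCLike 𝕜] :
    -- eigenfunctions of `U_n` restrict to eigenvectors of `(1/n) L_n`
    (∀ (z : 𝕜) (f : C(𝒳, 𝕜)), IsEigenvector (empLapOp 𝕜 k X) z f →
      scaledLaplacian 𝕜 k X (sampleRestrict X f) = z • sampleRestrict X f ∧
      ((∃ a, f a ≠ 0 ∧ empDegree 𝕜 k X a ≠ z) →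
        Module.End.HasEigenvector (scaledLaplacian 𝕜 k X) z (sampleRestrict X f))) ∧
    -- eigenfunctions for eigenvalues outside the range of `d_n` are given by the formula
    (∀ (z : 𝕜) (f : C(𝒳, 𝕜)), z ∉ Set.range (empDegree 𝕜 k X) →
      IsEigenvector (empLapOp 𝕜 k X) z f →
      ∀ a, f a = extension k X z (sampleRestrict X f) a) ∧
    -- the formula extends eigenvectors of `(1/n) L_n` to eigenfunctions of `U_n`
    (∀ (z : 𝕜) (v : Fin n → 𝕜), z ∉ Set.range (empDegree 𝕜 k X) →
      Module.End.HasEigenvector (scaledLaplacian 𝕜 k X) z v →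
      ∃ f : C(𝒳, 𝕜), (∀ a, f a = extension k X z v a) ∧
        IsEigenvector (empLapOp 𝕜 k X) z f ∧ sampleRestrict X f = v) ∧
    -- essential spectrum and eigenvalues of `U_n`
    (essentialSpectrum (empLapOp ℂ k X) ⊆ Set.range (empDegree ℂ k X) ∧
      ((∀ a : 𝒳, ¬ IsOpen ({a} : Set 𝒳)) →
        essentialSpectrum (empLapOp ℂ k X) = Set.range (empDegree ℂ k X)) ∧
      (∀ z ∈ eigenvalueSet (empLapOp ℂ k X), z.im = 0 ∧ 0 ≤ z.re) ∧
      (∀ z : ℂ, AccPt z (Filter.principal (eigenvalueSet (empLapOp ℂ k X))) →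
        z ∈ Set.range (empDegree ℂ k X))) ∧
    -- essential spectrum and eigenvalues of `U`
    (essentialSpectrum (lapOp ℂ k P) ⊆ Set.range (degreeIn ℂ k P) ∧
      ((∀ a : 𝒳, ¬ IsOpen ({a} : Set 𝒳)) →
        essentialSpectrum (lapOp ℂ k P) = Set.range (degreeIn ℂ k P)) ∧
      (∀ z ∈ eigenvalueSet (lapOp ℂ k P), z.im = 0 ∧ 0 ≤ z.re) ∧
      (∀ z : ℂ, AccPt z (Filter.principal (eigenvalueSet (lapOp ℂ k P))) →
        z ∈ Set.range (degreeIn ℂ k P))) := by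
  obtain ⟨l, hl, hkl⟩ := hpos
  have hk : ∀ a b, 0 ≤ k (a, b) := fun a b => (hl.trans (hkl a b)).le
  refine ⟨fun z f hf => ?_, fun z f hz hf a => ?_, fun z v hz hv => ?_,
    essentialSpectrum_and_eigenvalues_lapOp k hsymm hk (empiricalMeasure X), essentialSpectrum_and_eigenvalues_lapOp k hsymm hk P⟩
  · have hf' := (isEigenvector_iff.1 hf).1
    refine ⟨scaledLaplacian_sampleRestrict_eq_smul hf', fun ⟨a, ha, haz⟩ => ?_⟩
    exact Module.End.hasEigenvector_iff.2 ⟨Module.End.mem_eigenspace_iff.2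
      (scaledLaplacian_sampleRestrict_eq_smul hf'), sampleRestrict_ne_zero hf' ha haz⟩
  · exact eq_extension_sampleRestrict (isEigenvector_iff.1 hf).1 fun h => hz ⟨a, h⟩
  · exact exists_isEigenvector_extension hz hv.apply_eq_smul hv.2
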